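/- Let $\mathbb{O}=\mathbb{R}^8$ be the octonions with standard basis $e_0=1,e_1,\dots,e_7$ and $e_ie_j=-\delta_{ij}+\sum_k\epsilon_{ijk}e_k$ for $i,j\ge 1$, where $\epsilon_{ijk}$ is totally antisymmetric, equals $1$ on the triples $(1,2,3),(1,4,5),(2,4,6),(3,4,7),(5,3,6),(6,1,7),(7,2,5)$, and vanishes off their permutations. Fix $0\le p\le 6$. Write each $\boldsymbol{x}\in\mathbb{O}$ as $\boldsymbol{x}=\boldsymbol{x}_p+r\underline{\omega}$ with $\boldsymbol{x}_p=\sum_{i=0}^p x_ie_i$, identified with $(x_0,\dots,x_p)\in\mathbb{R}^{p+1}$, $r\ge 0$, and $\underline{\omega}$ in the unit sphere of $\mathrm{span}_{\mathbb{R}}(e_{p+1},\dots,e_7)$ (when $r=0$, $\underline{\omega}$ is arbitrary and the functions below do not depend on it). The Fueter variables are $z_\ell(\boldsymbol{x})=x_\ell+r\underline{\omega}e_\ell$, $0\le\ell\le p$. For a polynomial $f_0:\mathbb{R}^{p+1}\to\mathbb{O}$ let $$CK[f_0](\boldsymbol{x})=\sum_{j\ge 0}\frac{r^{2j}}{(2j)!}(-\Delta)^jf_0(\boldsymbol{x}_p)+\underline{\omega}\sum_{j\ge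 0}\frac{r^{2j+1}}{(2j+1)!}(-\Delta)^j(Df_0)(\boldsymbol{x}_p),$$ where $\Delta=\sum_{i=0}^p\partial_{x_i}^2$ and $D=\sum_{i=0}^p e_i\partial_{x_i}$. For $\mathrm{k}=(k_0,\dots,k_p)\in\mathbb{N}^{p+1}$ put $|\mathrm{k}|=k_0+\dots+k_p$, $\mathrm{k}!=k_0!\cdots k_p!$ and $$V_{\mathrm{k}}=\frac{1}{\mathrm{k}!}CK[x_0^{k_0}\cdots x_p^{k_p}],\qquad \mathcal{P}_{\mathrm{k}}=\frac{1}{|\mathrm{k}|!}\sum_{(i_1,\dots,i_{|\mathrm{k}|})}\big(\cdots((z_{i_1}z_{i_2})z_{i_3})\cdots\big)z_{i_{|\mathrm{k}|}},$$ where the sum runs over all sequences in $\{0,\dots,p\}^{|\mathrm{k}|}$ in which each $\ell$ occurs exactly $k_\ell$ times (and $\mathcal{P}_{\mathbf{0}}=1$). Theorem. For every $\mathrm{k}\in\mathbb{N}^{p+1}$ and every $\boldsymbol{x}\in\mathbb{O}$, $$V_{\mathrm{k}}(\boldsymbol{x})=\mathcal{P}_{\mathrm{k}}(\boldsymbol{x}).$$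 Moreover $\mathcal{P}_{\mathrm{k}}$ does not depend on the bracketing: for $|\mathrm{k}|\ge 1$, if in the definition of $\mathcal{P}_{\mathrm{k}}$ every product $z_{i_1}z_{i_2}\cdots z_{i_{|\mathrm{k}|}}$ is instead evaluated with one and the same arbitrary complete bracketing of $|\mathrm{k}|$ ordered factors, the resulting function is again $\mathcal{P}_{\mathrm{k}}$. -/

import Mathlib

open scoped BigOperators

namespace OctonionFueter

noncomputable section

/-! ## The octonions -/

/-- The seven oriented triples that determine the multiplication table. -/
def triples : List (Fin 8 × Fin 8 × Fin 8) :=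
  [(1, 2, 3), (1, 4, 5), (2, 4, 6), (3, 4, 7), (5, 3, 6), (6, 1, 7), (7, 2, 5)]

/-- The symbol `ε i j k`: the sign of the permutation that carries one of the seven triples to
`(i, j, k)`, and `0` if there is none. -/
def epsilon (i j k : Fin 8) : ℤ :=
  if (i, j, k) ∈ triples ∨ (j, k, i) ∈ triples ∨ (k, i, j) ∈ triples then 1
  else if (j, i, k) ∈ triples ∨ (i, k, j) ∈ triples ∨ (k, j, i) ∈ triples then -1
  else 0

/-- The coefficient of `e k` in the product `e i * e j`: the element `e 0` is the unit, and
`e i * e j = -δ i j + ∑ k, ε i j k e k` for `i, j ≥ 1`. -/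
def structConst (i j k : Fin 8) : ℤ :=
  if i = 0 then (if k = j then 1 else 0)
  else if j = 0 then (if k = i then 1 else 0)
  else (if k = 0 ∧ i = j then -1 else 0) + epsilon i j k

/-- The octonions: the Euclidean space `ℝ⁸`, with the multiplication given below. -/
abbrev Octonion : Type := EuclideanSpace ℝ (Fin 8)

/-- The octonion product: the bilinear extension of the multiplication table. -/
instance instMulOctonion : Mul Octonion where
  mul x y := WithLp.toLp 2 fun k => ∑ i, ∑ j, (structConst i j k : ℝ) * (x i * y j)

/-- The standard basis `e 0 = 1, e 1, …, e 7`. -/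
def e (i : Fin 8) : Octonion := EuclideanSpace.single i 1

/-! ## The splitting `ℝ⁸ = ℝ^(p+1) ⊕ ℝ^q`, `0 ≤ p ≤ 6`, `q = 7 - p` -/

/-- The inclusion of the indices `0, …, p` into `0, …, 7`. -/
def idx (p : Fin 7) : Fin (p.val + 1) → Fin 8 := Fin.castLE (by omega)

/-- The component of `x` in `ℝ^(p+1)`, as the tuple `(x_0, …, x_p)`. -/
def headPart (p : Fin 7) (x : Octonion) : Fin (p.val + 1) → ℝ := fun l => x (idx p l)

/-- The octonion `x_0 + x_1 e_1 + ⋯ + x_p e_p`. -/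
def ofHead (p : Fin 7) (y : Fin (p.val + 1) → ℝ) : Octonion := ∑ l, y l • e (idx p l)

/-- The component `x_{p+1} e_{p+1} + ⋯ + x_7 e_7` of `x`. -/
def tailPart (p : Fin 7) (x : Octonion) : Octonion :=
  WithLp.toLp 2 fun i => if i.val ≤ p.val then 0 else x i

/-- The unit sphere of `ℝ^q`. -/
def unitSphere (p : Fin 7) : Set Octonion :=
  {ω | (∀ i : Fin 8, i.val ≤ p.val → ω i = 0) ∧ ∑ i, ω i ^ 2 = 1}

/-- `r`, the modulus of the component in `ℝ^q`. -/
def radius (p : Fin 7) (x : Octonion) : ℝ := ‖tailPart p x‖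

/-- A direction `ω` in the unit sphere of `ℝ^q` with `x = x_p + r ω`.  It is unique when `r ≠ 0`;
when `r = 0` every `ω` will do, and `e 7` is taken. -/
def direction (p : Fin 7) (x : Octonion) : Octonion :=
  if radius p x = 0 then e 7 else (radius p x)⁻¹ • tailPart p x

/-! ## Fueter variables and Fueter polynomials -/

/-- The value `x_l + (r ω) e_l` of the `l`-th left Fueter variable at `x_p + r ω`. -/
def fueterVarAt (p : Fin 7) (y : Fin (p.val + 1) → ℝ) (r : ℝ) (ω : Octonion)
    (l : Fin (p.val + 1)) : Octonion :=
  y l • e 0 + (r • ω) * e (idx p l)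

/-- The left Fueter variable `z_l`, as a function on the octonions. -/
def fueterVar (p : Fin 7) (l : Fin (p.val + 1)) (x : Octonion) : Octonion :=
  fueterVarAt p (headPart p x) (radius p x) (direction p x) l

/-- The associative orders (complete bracketings) of a product of `n` ordered factors. -/
inductive Bracketing : ℕ → Type
  | leaf : Bracketing 1
  | node {m n : ℕ} (a : Bracketing m) (b : Bracketing n) : Bracketing (m + n)

/-- The product of the ordered factors `v 0, …, v (n - 1)` in a given associative order. -/
def Bracketing.prod : {n : ℕ} → Bracketing n → (Fin n → Octonion) → Octonion
  | _, .leaf, v => v 0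
  | _, .node (m := m) (n := n) a b, v =>
      a.prod (fun i => v (Fin.castAdd n i)) * b.prod (fun i => v (Fin.natAdd m i))

/-- The product of ordered factors from left to right, `((v 0 * v 1) * v 2) * ⋯`; the product of
no factors is `1`. -/
def leftProd : (n : ℕ) → (Fin n → Octonion) → Octonion
  | 0, _ => e 0
  | 1, v => v 0
  | n + 2, v => leftProd (n + 1) (fun i => v i.castSucc) * v (Fin.last (n + 1))

/-- The total degree `|k|` of a multi-index. -/
abbrev degree {p : Fin 7} (k : Fin (p.val + 1) → ℕ) : ℕ := ∑ l, k l

/-- The distinct rearrangements of the alignment `(0, …, 0, 1, …, 1, …, p, …, p)` in which each `l`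
occurs `k l` times: the index sequences of length `|k|` that take each value `l` exactly `k l`
times. -/
def alignments {p : Fin 7} (k : Fin (p.val + 1) → ℕ) :
    Finset (Fin (degree k) → Fin (p.val + 1)) :=
  Finset.univ.filter fun s => ∀ l, (Finset.univ.filter fun m => s m = l).card = k l

/-- The symmetrized product of the Fueter variables in a given associative order. -/
def fueterPolyWith {p : Fin 7} (k : Fin (p.val + 1) → ℕ) (B : Bracketing (degree k))
    (x : Octonion) : Octonion :=
  ((degree k).factorial : ℝ)⁻¹ • ∑ s ∈ alignments k, B.prod fun m => fueterVar p (s m) x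

/-- The octonionic Fueter polynomial `P_k`, with the products taken from left to right. -/
def fueterPoly {p : Fin 7} (k : Fin (p.val + 1) → ℕ) (x : Octonion) : Octonion :=
  ((degree k).factorial : ℝ)⁻¹ •
    ∑ s ∈ alignments k, leftProd (degree k) fun m => fueterVar p (s m) x

/-! ## The Cauchy-Kovalevskaya extension -/

/-- The partial derivative of an octonion valued function of `(x_0, …, x_p)`. -/
def partialDeriv {p : Fin 7} (l : Fin (p.val + 1)) (f : (Fin (p.val + 1) → ℝ) → Octonion) :
    (Fin (p.val + 1) → ℝ) → Octonion :=
  fun y => lineDeriv ℝ f y (Pi.single l 1)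

/-- `-Δ`, for the Laplacian `Δ` of `ℝ^(p+1)`. -/
def negLaplacian {p : Fin 7} (f : (Fin (p.val + 1) → ℝ) → Octonion) :
    (Fin (p.val + 1) → ℝ) → Octonion :=
  fun y => -∑ l, partialDeriv l (partialDeriv l f) y

/-- The generalized Cauchy-Riemann operator `∑ e_l ∂_l` of `ℝ^(p+1)`. -/
def cauchyRiemann {p : Fin 7} (f : (Fin (p.val + 1) → ℝ) → Octonion) :
    (Fin (p.val + 1) → ℝ) → Octonion :=
  fun y => ∑ l, e (idx p l) * partialDeriv l f y

/-- The value of the extension of `f` at `x_p + r ω`.  The series are finite sums when `f` is a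
polynomial. -/
def ckAt {p : Fin 7} (f : (Fin (p.val + 1) → ℝ) → Octonion) (y : Fin (p.val + 1) → ℝ) (r : ℝ)
    (ω : Octonion) : Octonion :=
  ∑' j : ℕ, (r ^ (2 * j) / ((2 * j).factorial : ℝ)) • (negLaplacian^[j] f) y +
    ω * ∑' j : ℕ, (r ^ (2 * j + 1) / ((2 * j + 1).factorial : ℝ)) •
      (negLaplacian^[j] (cauchyRiemann f)) y

/-- The generalized partial-slice Cauchy-Kovalevskaya extension `CK[f]`, as a function on the
octonions. -/
def ck {p : Fin 7} (f : (Fin (p.val + 1) → ℝ) → Octonion) (x : Octonion) : Octonion :=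
  ckAt f (headPart p x) (radius p x) (direction p x)

/-- The real monomial `x_0 ^ k_0 ⋯ x_p ^ k_p`, as an octonion valued function. -/
def monomialFun {p : Fin 7} (k : Fin (p.val + 1) → ℕ) : (Fin (p.val + 1) → ℝ) → Octonion :=
  fun y => (∏ l, y l ^ k l) • e 0

/-- `V_k = CK[x_p ^ k] / k!`. -/
def ckMonomial {p : Fin 7} (k : Fin (p.val + 1) → ℕ) (x : Octonion) : Octonion :=
  ((∏ l, (k l).factorial : ℕ) : ℝ)⁻¹ • ck (monomialFun k) x

/-! ## The functions above do not depend on the choice of `ω` -/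

theorem mul_apply (x y : Octonion) (k : Fin 8) :
    (x * y) k = ∑ i, ∑ j, (structConst i j k : ℝ) * (x i * y j) := rfl

theorem ofHead_apply (p : Fin 7) (y : Fin (p.val + 1) → ℝ) (i : Fin 8) :
    ofHead p y i = if h : i.val < p.val + 1 then y ⟨i.val, h⟩ else 0 := by
  have key : ofHead p y i = ∑ l, if i = idx p l then y l else 0 := by
    simp [ofHead, e, Pi.single_apply]
  rw [key]
  split_ifs with h
  · rw [Finset.sum_eq_single ⟨i.val, h⟩]
    · simp [idx]
    · intro b _ hb
      rw [if_neg]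
      intro hi
      apply hb
      ext
      simp [hi, idx]
    · simp
  · apply Finset.sum_eq_zero
    intro l _
    rw [if_neg]
    intro hi
    apply h
    rw [hi]
    exact l.2

theorem unitSphere_norm {p : Fin 7} {ω : Octonion} (hω : ω ∈ unitSphere p) : ‖ω‖ = 1 := by
  rw [EuclideanSpace.norm_eq]
  simp [hω.2]

theorem headPart_add {p : Fin 7} (y : Fin (p.val + 1) → ℝ) (r : ℝ) {ω : Octonion}
    (hω : ω ∈ unitSphere p) : headPart p (ofHead p y + r • ω) = y := by
  funext l
  have h0 : ω (idx p l) = 0 := hω.1 _ (by have := l.2; simp [idx]; omega)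
  have hl : (idx p l).val < p.val + 1 := l.2
  simp [headPart, h0, ofHead_apply, hl]
  rfl

theorem tailPart_add {p : Fin 7} (y : Fin (p.val + 1) → ℝ) (r : ℝ) {ω : Octonion}
    (hω : ω ∈ unitSphere p) : tailPart p (ofHead p y + r • ω) = r • ω := by
  ext i
  by_cases h : i.val ≤ p.val
  · simp [tailPart, h, hω.1 i h]
  · simp [tailPart, h, ofHead_apply]

theorem radius_add {p : Fin 7} (y : Fin (p.val + 1) → ℝ) {r : ℝ} (hr : 0 ≤ r) {ω : Octonion}
    (hω : ω ∈ unitSphere p) : radius p (ofHead p y + r • ω) = r := by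
  rw [radius, tailPart_add y r hω, norm_smul, unitSphere_norm hω, Real.norm_of_nonneg hr, mul_one]

theorem direction_add {p : Fin 7} (y : Fin (p.val + 1) → ℝ) {r : ℝ} (hr : 0 < r) {ω : Octonion}
    (hω : ω ∈ unitSphere p) : direction p (ofHead p y + r • ω) = ω := by
  rw [direction, radius_add y hr.le hω, if_neg hr.ne', tailPart_add y r hω, smul_smul,
    inv_mul_cancel₀ hr.ne', one_smul]

/-- Every octonion is `x_p + r ω` with `r` and `ω` as above. -/
theorem eq_head_add (p : Fin 7) (x : Octonion) :
    x = ofHead p (headPart p x) + radius p x • direction p x ∧ 0 ≤ radius p x ∧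
      direction p x ∈ unitSphere p := by
  have ht : radius p x • direction p x = tailPart p x := by
    rw [direction]
    split_ifs with h
    · rw [h, zero_smul]
      exact (norm_eq_zero.1 h).symm
    · rw [smul_smul, mul_inv_cancel₀ h, one_smul]
  refine ⟨?_, norm_nonneg _, ?_⟩
  · rw [ht]
    ext i
    by_cases h : i.val ≤ p.val
    · simp [tailPart, h, ofHead_apply, headPart, show i.val < p.val + 1 by omega, idx]
    · simp [tailPart, h, ofHead_apply, show ¬ i.val < p.val + 1 by omega]
  · rw [direction]
    split_ifs with h
    · refine ⟨fun i hi => ?_, ?_⟩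
      · have : i ≠ 7 := by rintro rfl; have := p.2; simp at hi; omega
        simp [e, this]
      · simp [e, PiLp.single_apply]
    · refine ⟨fun i hi => by simp [tailPart, hi], ?_⟩
      have h1 : ‖(radius p x)⁻¹ • tailPart p x‖ = 1 := by
        rw [norm_smul, norm_inv, Real.norm_of_nonneg (show 0 ≤ radius p x from norm_nonneg _)]
        exact inv_mul_cancel₀ h
      have h2 := EuclideanSpace.real_norm_sq_eq ((radius p x)⁻¹ • tailPart p x)
      rw [← h2, h1, one_pow]

/-- The Fueter variables are given by `x_l + (r ω) e_l` for every representation `x_p + r ω`. -/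
theorem fueterVar_add {p : Fin 7} (l : Fin (p.val + 1)) (y : Fin (p.val + 1) → ℝ) {r : ℝ}
    (hr : 0 ≤ r) {ω : Octonion} (hω : ω ∈ unitSphere p) :
    fueterVar p l (ofHead p y + r • ω) = fueterVarAt p y r ω l := by
  rw [fueterVar, headPart_add y r hω, radius_add y hr hω]
  rcases hr.eq_or_lt with h | h
  · subst h
    simp [fueterVarAt]
  · rw [direction_add y h hω]

/-- The extension is given by its series for every representation `x_p + r ω`. -/
theorem ck_add {p : Fin 7} (f : (Fin (p.val + 1) → ℝ) → Octonion) (y : Fin (p.val + 1) → ℝ) {r : ℝ}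
    (hr : 0 ≤ r) {ω : Octonion} (hω : ω ∈ unitSphere p) :
    ck f (ofHead p y + r • ω) = ckAt f y r ω := by
  rw [ck, headPart_add y r hω, radius_add y hr hω]
  rcases hr.eq_or_lt with h | h
  · subst h
    have hz : ∀ w : Octonion, w * 0 = 0 := by
      intro w
      ext k
      simp [mul_apply]
    simp [ckAt, hz]
  · rw [direction_add y h hω]

end

end OctonionFueter

/-!
For real weights `t`, the combination `∑ t_l z_l` of the Fueter variables at `y + r ω` equals
`a + r u` with `a = ∑ t_l y_l` real and `u = ω (∑ t_l e_l)`.  As `ω` is orthogonal to the `e_l`, the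
octonion `u` is imaginary, so `u² = -∑ t_l²`, and `a + r u` lies in a commutative and associative
plane.  Hence its `n`-th power is the same for every bracketing, and expanding it multilinearly
gives `∑_{|k| = n} n! t^k P_k`, with `P_k` formed for that bracketing.  On the other hand
`(-Δ)^j` and `(-Δ)^j D` act on `(∑ t_l y_l)^n` as multiples of `u^(2j)` and `ω⁻¹ u^(2j+1)`, so
by the binomial theorem the power is also the extension of `(∑ t_l y_l)^n`, which is
`∑_{|k| = n} n! t^k V_k`.  Comparing the coefficients of `t^k` gives the theorem.
-/

namespace OctonionFueter

noncomputable section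

/-! ## Octonion algebra -/

instance : NonUnitalNonAssocRing Octonion :=
  { (inferInstance : AddCommGroup Octonion), instMulOctonion with
    left_distrib := fun x y z => by
      ext k
      simp [mul_apply, mul_add, Finset.sum_add_distrib]
    right_distrib := fun x y z => by
      ext k
      simp [mul_apply, add_mul, mul_add, Finset.sum_add_distrib]
    zero_mul := fun x => by ext k; simp [mul_apply]
    mul_zero := fun x => by ext k; simp [mul_apply] }

instance : IsScalarTower ℝ Octonion Octonion where
  smul_assoc c x y := by
    ext k
    simp only [smul_eq_mul, mul_apply, PiLp.smul_apply, Finset.mul_sum]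
    exact Finset.sum_congr rfl fun i _ => Finset.sum_congr rfl fun j _ => by ring

instance : SMulCommClass ℝ Octonion Octonion where
  smul_comm c x y := by
    ext k
    simp only [smul_eq_mul, mul_apply, PiLp.smul_apply, Finset.mul_sum]
    exact Finset.sum_congr rfl fun i _ => Finset.sum_congr rfl fun j _ => by ring

theorem mul_eq_toLp (x y : Octonion) : x * y = WithLp.toLp 2
    ![x 0 * y 0 - x 1 * y 1 - x 2 * y 2 - x 3 * y 3 - x 4 * y 4 - x 5 * y 5 - x 6 * y 6 - x 7 * y 7,
      x 0 * y 1 + x 1 * y 0 + x 2 * y 3 - x 3 * y 2 + x 4 * y 5 - x 5 * y 4 + x 7 * y 6 - x 6 * y 7,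
      x 0 * y 2 + x 2 * y 0 + x 3 * y 1 - x 1 * y 3 + x 4 * y 6 - x 6 * y 4 + x 5 * y 7 - x 7 * y 5,
      x 0 * y 3 + x 3 * y 0 + x 1 * y 2 - x 2 * y 1 + x 4 * y 7 - x 7 * y 4 + x 6 * y 5 - x 5 * y 6,
      x 0 * y 4 + x 4 * y 0 + x 5 * y 1 - x 1 * y 5 + x 6 * y 2 - x 2 * y 6 + x 7 * y 3 - x 3 * y 7,
      x 0 * y 5 + x 5 * y 0 + x 1 * y 4 - x 4 * y 1 + x 3 * y 6 - x 6 * y 3 + x 7 * y 2 - x 2 * y 7,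
      x 0 * y 6 + x 6 * y 0 + x 2 * y 4 - x 4 * y 2 + x 5 * y 3 - x 3 * y 5 + x 1 * y 7 - x 7 * y 1,
      x 0 * y 7 + x 7 * y 0 + x 3 * y 4 - x 4 * y 3 + x 6 * y 1 - x 1 * y 6 + x 2 * y 5 - x 5 * y 2]
    := by
  ext k
  fin_cases k <;>
  · simp [mul_apply, Fin.sum_univ_eight, structConst, epsilon, triples]
    try ring

theorem e_zero_mul (x : Octonion) : e 0 * x = x := by
  ext k
  fin_cases k <;> simp [mul_eq_toLp, e]

theorem mul_e_zero (x : Octonion) : x * e 0 = x := by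
  ext k
  fin_cases k <;> simp [mul_eq_toLp, e]

instance : NormMulClass Octonion where
  norm_mul x y := by
    refine (sq_eq_sq₀ (norm_nonneg _) (by positivity)).1 ?_
    simp only [mul_pow, EuclideanSpace.real_norm_sq_eq, mul_eq_toLp, Fin.sum_univ_eight]
    simp
    ring

instance : NoZeroDivisors Octonion where
  eq_zero_or_eq_zero_of_mul_eq_zero {x y} hxy := by
    rw [← norm_eq_zero, norm_mul, mul_eq_zero] at hxy
    simpa only [norm_eq_zero] using hxy

theorem mul_apply_zero (x y : Octonion) : (x * y) 0 = 2 * (x 0 * y 0) - inner ℝ x y := by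
  simp only [mul_eq_toLp, PiLp.inner_apply, Fin.sum_univ_eight]
  simp
  ring

theorem mul_self_of_apply_zero {x : Octonion} (hx : x 0 = 0) : x * x = -‖x‖ ^ 2 • e 0 := by
  ext k
  fin_cases k <;>
  · simp [mul_eq_toLp, EuclideanSpace.real_norm_sq_eq, Fin.sum_univ_eight, e, hx]
    try ring

theorem norm_sq_ofHead {p : Fin 7} (t : Fin (p.val + 1) → ℝ) : ‖ofHead p t‖ ^ 2 = t ⬝ᵥ t := by
  have orthonormal_e : Orthonormal ℝ e := EuclideanSpace.orthonormal_single
  have orthonormal_e_idx := orthonormal_e.comp (idx p) (Fin.castLE_injective _)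
  rw [← real_inner_self_eq_norm_sq, ofHead]
  exact orthonormal_e_idx.inner_sum t t Finset.univ

theorem inner_unitSphere_ofHead {p : Fin 7} {ω : Octonion} (hω : ω ∈ unitSphere p)
    (t : Fin (p.val + 1) → ℝ) : inner ℝ ω (ofHead p t) = 0 := by
  have inner_e_idx (l : Fin (p.val + 1)) : inner ℝ ω (e (idx p l)) = 0 := by
    simpa [e, EuclideanSpace.inner_single_right] using hω.1 (idx p l) (Nat.le_of_lt_succ l.2)
  simp only [ofHead, inner_sum, inner_smul_right, inner_e_idx, mul_zero, Finset.sum_const_zero]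

theorem mul_ofHead_mul_self {p : Fin 7} {ω : Octonion} (hω : ω ∈ unitSphere p)
    (t : Fin (p.val + 1) → ℝ) :
    (ω * ofHead p t) * (ω * ofHead p t) = -(t ⬝ᵥ t) • e 0 := by
  have imaginary : (ω * ofHead p t) 0 = 0 := by
    rw [mul_apply_zero, inner_unitSphere_ofHead hω, hω.1 0 (Nat.zero_le _)]
    ring
  rw [mul_self_of_apply_zero imaginary, norm_mul, unitSphere_norm hω, one_mul, norm_sq_ofHead]

/-! ## Quadratic subalgebras of the octonions -/

section Quadratic

open QuadraticAlgebra

variable {N : ℝ} {u : Octonion} (hu : u * u = N • e 0)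

/-- The homomorphism from the commutative and associative algebra `ℝ[√N]` to the octonions
that sends `√N` to a given square root `u` of `N`.  It sends `1` to `e 0`. -/
def quadraticHom : QuadraticAlgebra ℝ N 0 →ₙₐ[ℝ] Octonion where
  toFun z := z.re • e 0 + z.im • u
  map_smul' c z := by simp [mul_smul]
  map_zero' := by simp
  map_add' z w := by
    simp only [re_add, im_add]
    module
  map_mul' z w := by
    simp only [re_mul, im_mul, add_mul, mul_add, smul_mul_assoc, mul_smul_comm, hu, e_zero_mul,
      mul_e_zero]
    module

theorem quadraticHom_one : quadraticHom hu 1 = e 0 := by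
  simp [quadraticHom, re_one, im_one]

theorem quadraticHom_mk (a b : ℝ) : quadraticHom hu ⟨a, b⟩ = a • e 0 + b • u := rfl

theorem quadraticHom_omega_pow_two_mul (j : ℕ) :
    quadraticHom hu (omega ^ (2 * j)) = N ^ j • e 0 := by
  have omega_sq : (omega ^ 2 : QuadraticAlgebra ℝ N 0) = N • 1 := by
    rw [sq, omega_mul_omega_eq_add, zero_smul, add_zero]
  rw [pow_mul, omega_sq, smul_pow, one_pow, map_smul, quadraticHom_one]

theorem quadraticHom_omega_pow_two_mul_add_one (j : ℕ) :
    quadraticHom hu (omega ^ (2 * j + 1)) = N ^ j • u := by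
  have map_omega : quadraticHom hu omega = u := by simp [quadraticHom]
  rw [pow_succ, map_mul, quadraticHom_omega_pow_two_mul, map_omega, smul_mul_assoc, e_zero_mul]

theorem quadraticHom_mk_pow (a r : ℝ) (n : ℕ) :
    quadraticHom hu (⟨a, r⟩ ^ n) = ∑ m ∈ Finset.range (n + 1),
      (n.choose m * a ^ (n - m) * r ^ m) • quadraticHom hu (omega ^ m) := by
  rw [mk_eq_add_smul_omega, add_comm, add_pow, map_sum]
  refine Finset.sum_congr rfl fun m _ => ?_
  rw [← map_smul]
  congr 1
  rw [Algebra.smul_def, Algebra.smul_def]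
  simp only [mul_pow, map_mul, map_pow, map_natCast]
  ring

end Quadratic

/-! ## Bracketings as multilinear maps -/

namespace Bracketing

/-- `Bracketing.prod` as a multilinear map. -/
def prodMultilinear : {n : ℕ} → Bracketing n →
    MultilinearMap ℝ (fun _ : Fin n => Octonion) Octonion
  | _, .leaf => MultilinearMap.ofSubsingleton ℝ Octonion Octonion 0 LinearMap.id
  | _, .node a b => ((LinearMap.mul' ℝ Octonion).compMultilinearMap
      (a.prodMultilinear.domCoprod b.prodMultilinear)).domDomCongr finSumFinEquiv

theorem prodMultilinear_apply {n : ℕ} (B : Bracketing n) (v : Fin n → Octonion) :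
    B.prodMultilinear v = B.prod v := by
  induction B with
  | leaf => rfl
  | node a b iha ihb => exact congrArg₂ (· * ·) (iha _) (ihb _)

theorem prod_map_const {M : Type*} [Monoid M] (φ : M →ₙ* Octonion) (z : M) {n : ℕ}
    (B : Bracketing n) : B.prod (fun _ => φ z) = φ (z ^ n) := by
  induction B with
  | leaf => simp [prod]
  | node a b iha ihb => rw [prod, iha, ihb, pow_add, map_mul]

/-- The bracketing `((v 0 * v 1) * v 2) * ⋯`, which is that of `leftProd`. -/
def left : (n : ℕ) → Bracketing (n + 1)
  | 0 => .leaf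
  | n + 1 => .node (left n) .leaf

theorem prod_left (n : ℕ) (v : Fin (n + 1) → Octonion) :
    (left n).prod v = leftProd (n + 1) v := by
  induction n with
  | zero => rfl
  | succ n ih => exact congrArg (· * v (Fin.last (n + 1))) (ih fun i => v i.castSucc)

end Bracketing

/-- `leftProd` as a multilinear map. -/
def leftProdMultilinear : (n : ℕ) → MultilinearMap ℝ (fun _ : Fin n => Octonion) Octonion
  | 0 => MultilinearMap.constOfIsEmpty ℝ _ (e 0)
  | n + 1 => (Bracketing.left n).prodMultilinear

theorem leftProdMultilinear_apply (n : ℕ) (v : Fin n → Octonion) :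
    leftProdMultilinear n v = leftProd n v := by
  cases n with
  | zero => rfl
  | succ n => rw [leftProdMultilinear, Bracketing.prodMultilinear_apply, Bracketing.prod_left]

/-- An `n`-fold multilinear product computes powers if its value at a constant family in a plane
`ℝ + ℝ u` with `u * u` real is the `n`-th power there. -/
def ComputesPowers {n : ℕ} (F : MultilinearMap ℝ (fun _ : Fin n => Octonion) Octonion) : Prop :=
  ∀ ⦃N : ℝ⦄ ⦃u : Octonion⦄ (hu : u * u = N • e 0) (z : QuadraticAlgebra ℝ N 0),
    F (fun _ => quadraticHom hu z) = quadraticHom hu (z ^ n)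

theorem Bracketing.computesPowers {n : ℕ} (B : Bracketing n) :
    ComputesPowers B.prodMultilinear := fun _ _ hu z => by
  rw [prodMultilinear_apply]
  exact B.prod_map_const (quadraticHom hu : _ →ₙ* Octonion) z

theorem computesPowers_leftProdMultilinear (n : ℕ) : ComputesPowers (leftProdMultilinear n) := by
  cases n with
  | zero =>
    intro N u hu z
    rw [pow_zero, quadraticHom_one]
    rfl
  | succ n => exact (Bracketing.left n).computesPowers

/-! ## Polarization -/

section Polarization

variable {ι R : Type*} [Fintype ι]

/-- The sequences of length `n` that take each value `l` exactly `k l` times.  For `n = degree k`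
these are the `alignments` of `k`. -/
def arrangements [DecidableEq ι] (n : ℕ) (k : ι → ℕ) : Finset (Fin n → ι) :=
  Finset.univ.filter fun s => ∀ l, (Finset.univ.filter fun m => s m = l).card = k l

theorem mem_arrangements [DecidableEq ι] {n : ℕ} {k : ι → ℕ} {s : Fin n → ι} :
    s ∈ arrangements n k ↔ ∀ l, (Finset.univ.filter fun m => s m = l).card = k l := by
  simp [arrangements]

theorem prod_comp_of_mem_arrangements [DecidableEq ι] [CommMonoid R] {n : ℕ} {k : ι → ℕ}
    {s : Fin n → ι}
    (hs : s ∈ arrangements n k) (t : ι → R) : ∏ m, t (s m) = ∏ l, t l ^ k l := by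
  rw [← Finset.prod_fiberwise' Finset.univ s t]
  refine Finset.prod_congr rfl fun l _ => ?_
  rw [Finset.prod_const, mem_arrangements.1 hs l]

theorem sum_eq_sum_piAntidiag_arrangements [DecidableEq ι] {M : Type*} [AddCommMonoid M] (n : ℕ)
    (f : (Fin n → ι) → M) :
    ∑ s, f s = ∑ k ∈ Finset.piAntidiag Finset.univ n, ∑ s ∈ arrangements n k, f s := by
  have count_mem (s : Fin n → ι) : (fun l => (Finset.univ.filter fun m => s m = l).card) ∈
      Finset.piAntidiag Finset.univ n := by
    rw [Finset.mem_piAntidiag, ← Finset.card_eq_sum_card_fiberwise fun _ _ => Finset.mem_univ _]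
    simp
  rw [← Finset.sum_fiberwise_of_maps_to fun s _ => count_mem s]
  refine Finset.sum_congr rfl fun k _ => Finset.sum_congr ?_ fun _ _ => rfl
  ext s
  simp [mem_arrangements, funext_iff]

theorem multilinearMap_sum_smul_eq_sum_piAntidiag [DecidableEq ι] [CommSemiring R] {M M' : Type*}
    [AddCommMonoid M] [Module R M] [AddCommMonoid M'] [Module R M'] {n : ℕ}
    (F : MultilinearMap R (fun _ : Fin n => M) M') (t : ι → R) (v : ι → M) :
    F (fun _ => ∑ l, t l • v l) = ∑ k ∈ Finset.piAntidiag Finset.univ n,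
      (∏ l, t l ^ k l) • ∑ s ∈ arrangements n k, F fun m => v (s m) := by
  rw [F.map_sum, sum_eq_sum_piAntidiag_arrangements]
  refine Finset.sum_congr rfl fun k _ => ?_
  rw [Finset.smul_sum]
  refine Finset.sum_congr rfl fun s hs => ?_
  rw [F.map_smul_univ, prod_comp_of_mem_arrangements hs]

theorem eq_of_sum_prod_pow_smul_eq [CommRing R] [IsDomain R] [Infinite R] {M : Type*}
    [AddCommGroup M] [Module R M] [Module.Projective R M] {S : Finset (ι → ℕ)}
    {A B : (ι → ℕ) → M}
    (h : ∀ t : ι → R, ∑ k ∈ S, (∏ l, t l ^ k l) • A k = ∑ k ∈ S, (∏ l, t l ^ k l) • B k)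
    {k : ι → ℕ} (hk : k ∈ S) : A k = B k := by
  classical
  rw [← sub_eq_zero, ← Module.forall_dual_apply_eq_zero_iff R]
  intro φ
  let P : MvPolynomial ι R :=
    ∑ k ∈ S, MvPolynomial.monomial (Finsupp.equivFunOnFinite.symm k) (φ (A k - B k))
  have eval_P (t : ι → R) : MvPolynomial.eval t P = 0 := by
    have hφ := congrArg φ (sub_eq_zero.2 (h t))
    simpa [P, MvPolynomial.eval_monomial, Finsupp.prod_fintype, mul_comm, mul_sub] using hφ
  have P_eq_zero : P = 0 := MvPolynomial.funext fun t => by rw [eval_P, map_zero]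
  have coeff_P : P.coeff (Finsupp.equivFunOnFinite.symm k) = φ (A k - B k) := by
    simp only [P, MvPolynomial.coeff_sum, MvPolynomial.coeff_monomial,
      EmbeddingLike.apply_eq_iff_eq, Finset.sum_ite_eq', hk, if_true]
  rw [← coeff_P, P_eq_zero, MvPolynomial.coeff_zero]

end Polarization

/-! ## The differential operators on smooth functions -/

section Smooth

open scoped ContDiff

variable {p : Fin 7} {m n : WithTop ℕ∞}

theorem partialDeriv_eq_fderiv {f : (Fin (p.val + 1) → ℝ) → Octonion} (hf : Differentiable ℝ f)
    (l : Fin (p.val + 1)) : partialDeriv l f = fun y => fderiv ℝ f y (Pi.single l 1) :=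
  funext fun y => (hf y).lineDeriv_eq_fderiv

theorem contDiff_partialDeriv {f : (Fin (p.val + 1) → ℝ) → Octonion} (hf : ContDiff ℝ n f)
    (hmn : m + 1 ≤ n) (l : Fin (p.val + 1)) : ContDiff ℝ m (partialDeriv l f) := by
  have one_le : 1 ≤ n := le_add_self.trans hmn
  rw [partialDeriv_eq_fderiv (hf.differentiable (zero_lt_one.trans_le one_le).ne')]
  exact (hf.fderiv_right hmn).clm_apply contDiff_const

theorem contDiff_negLaplacian {f : (Fin (p.val + 1) → ℝ) → Octonion} (hf : ContDiff ℝ n f)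
    (hmn : m + 1 + 1 ≤ n) : ContDiff ℝ m (negLaplacian f) :=
  (ContDiff.sum fun l _ => contDiff_partialDeriv (contDiff_partialDeriv hf hmn l) le_rfl l).neg

theorem contDiff_const_mul (c : Octonion) {E : Type*} [NormedAddCommGroup E] [NormedSpace ℝ E]
    {f : E → Octonion} (hf : ContDiff ℝ n f) : ContDiff ℝ n fun y => c * f y :=
  (LinearMap.mulLeft ℝ c).toContinuousLinearMap.contDiff.comp hf

theorem contDiff_cauchyRiemann {f : (Fin (p.val + 1) → ℝ) → Octonion} (hf : ContDiff ℝ n f)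
    (hmn : m + 1 ≤ n) : ContDiff ℝ m (cauchyRiemann f) :=
  ContDiff.sum fun l _ => contDiff_const_mul _ (contDiff_partialDeriv hf hmn l)

variable {κ : Type*} (S : Finset κ) (c : κ → ℝ) {f : κ → (Fin (p.val + 1) → ℝ) → Octonion}

theorem partialDeriv_sum_smul (hf : ∀ k, Differentiable ℝ (f k)) (l : Fin (p.val + 1)) :
    partialDeriv l (fun y => ∑ k ∈ S, c k • f k y) =
      fun y => ∑ k ∈ S, c k • partialDeriv l (f k) y := by
  have hcf (k : κ) : Differentiable ℝ fun y => c k • f k y := (hf k).const_smul (c k)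
  rw [partialDeriv_eq_fderiv (Differentiable.fun_sum fun k _ => hcf k)]
  funext y
  rw [fderiv_fun_sum fun k _ => hcf k y, sum_apply]
  refine Finset.sum_congr rfl fun k _ => ?_
  rw [fderiv_fun_const_smul (hf k y), partialDeriv_eq_fderiv (hf k), smul_apply]

theorem negLaplacian_sum_smul (hf : ∀ k, ContDiff ℝ 2 (f k)) :
    negLaplacian (fun y => ∑ k ∈ S, c k • f k y) =
      fun y => ∑ k ∈ S, c k • negLaplacian (f k) y := by
  have hf' (k : κ) : Differentiable ℝ (f k) := (hf k).differentiable two_ne_zero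
  have hdf (l : Fin (p.val + 1)) (k : κ) : Differentiable ℝ (partialDeriv l (f k)) :=
    (contDiff_partialDeriv (m := 1) (hf k) one_add_one_eq_two.le l).differentiable one_ne_zero
  funext y
  simp only [negLaplacian, partialDeriv_sum_smul S c hf', partialDeriv_sum_smul S c (hdf _)]
  rw [Finset.sum_comm]
  simp only [smul_neg, Finset.smul_sum, Finset.sum_neg_distrib]

theorem cauchyRiemann_sum_smul (hf : ∀ k, Differentiable ℝ (f k)) :
    cauchyRiemann (fun y => ∑ k ∈ S, c k • f k y) =
      fun y => ∑ k ∈ S, c k • cauchyRiemann (f k) y := by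
  funext y
  simp only [cauchyRiemann, partialDeriv_sum_smul S c hf, Finset.mul_sum, mul_smul_comm]
  rw [Finset.sum_comm]
  simp only [Finset.smul_sum]

theorem iterate_negLaplacian_sum_smul (hf : ∀ k, ContDiff ℝ ∞ (f k)) (j : ℕ) :
    negLaplacian^[j] (fun y => ∑ k ∈ S, c k • f k y) =
      fun y => ∑ k ∈ S, c k • negLaplacian^[j] (f k) y := by
  induction j generalizing f with
  | zero => rfl
  | succ j ih =>
    have two_le_infty : (2 : WithTop ℕ∞) ≤ ∞ := WithTop.coe_le_coe.2 le_top
    simp only [Function.iterate_succ_apply]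
    rw [negLaplacian_sum_smul S c fun k => (hf k).of_le two_le_infty,
      ih fun k => contDiff_negLaplacian (hf k) le_rfl]

theorem contDiff_monomialFun (k : Fin (p.val + 1) → ℕ) : ContDiff ℝ n (monomialFun k) := by
  unfold monomialFun
  fun_prop

end Smooth

/-! ## The coefficients of the Cauchy-Kovalevskaya extension -/

section Coefficients

variable {p : Fin 7}

/-- The coefficient of `r ^ m / m!` in the extension of `f` along the direction `ω`: it is
`(-Δ)^j f` for `m = 2 j`, and `ω (-Δ)^j D f` for `m = 2 j + 1`. -/
def ckCoeff (ω : Octonion) (f : (Fin (p.val + 1) → ℝ) → Octonion) (m : ℕ)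
    (y : Fin (p.val + 1) → ℝ) : Octonion :=
  if Even m then negLaplacian^[m / 2] f y else ω * negLaplacian^[m / 2] (cauchyRiemann f) y

theorem ckCoeff_two_mul (ω : Octonion) (f : (Fin (p.val + 1) → ℝ) → Octonion) (j : ℕ)
    (y : Fin (p.val + 1) → ℝ) : ckCoeff ω f (2 * j) y = negLaplacian^[j] f y := by
  rw [ckCoeff, if_pos (even_two_mul j), Nat.mul_div_cancel_left j two_pos]

theorem ckCoeff_two_mul_add_one (ω : Octonion) (f : (Fin (p.val + 1) → ℝ) → Octonion) (j : ℕ)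
    (y : Fin (p.val + 1) → ℝ) :
    ckCoeff ω f (2 * j + 1) y = ω * negLaplacian^[j] (cauchyRiemann f) y := by
  rw [ckCoeff, if_neg (Nat.not_even_two_mul_add_one j), show (2 * j + 1) / 2 = j by omega]

theorem ckCoeff_sum_smul (ω : Octonion) {κ : Type*} (S : Finset κ) (c : κ → ℝ)
    {f : κ → (Fin (p.val + 1) → ℝ) → Octonion} (hf : ∀ k, ContDiff ℝ (⊤ : ℕ∞) (f k)) (m : ℕ)
    (y : Fin (p.val + 1) → ℝ) :
    ckCoeff ω (fun y => ∑ k ∈ S, c k • f k y) m y = ∑ k ∈ S, c k • ckCoeff ω (f k) m y := by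
  obtain ⟨j, rfl | rfl⟩ := Nat.even_or_odd' m
  · simp only [ckCoeff_two_mul, iterate_negLaplacian_sum_smul S c hf]
  · simp only [ckCoeff_two_mul_add_one]
    rw [cauchyRiemann_sum_smul S c fun k => (hf k).differentiable (by simp),
      iterate_negLaplacian_sum_smul S c fun k => contDiff_cauchyRiemann (hf k) le_rfl,
      Finset.mul_sum]
    simp only [mul_smul_comm]

theorem ckAt_eq_sum_range {ω : Octonion} (hω : ω ≠ 0) {f : (Fin (p.val + 1) → ℝ) → Octonion}
    {y : Fin (p.val + 1) → ℝ} {n : ℕ} (hn : ∀ m, n ≤ m → ckCoeff ω f m y = 0) (r : ℝ) :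
    ckAt f y r ω = ∑ m ∈ Finset.range n, (r ^ m / m.factorial) • ckCoeff ω f m y := by
  have odd_eq_zero {j : ℕ} (hj : j ∉ Finset.range n) :
      negLaplacian^[j] (cauchyRiemann f) y = 0 := by
    refine (mul_eq_zero.1 ?_).resolve_left hω
    rw [← ckCoeff_two_mul_add_one]
    exact hn _ (by rw [Finset.mem_range] at hj; omega)
  have odd_summable : Summable fun j : ℕ => (r ^ (2 * j + 1) / ((2 * j + 1).factorial : ℝ)) •
      negLaplacian^[j] (cauchyRiemann f) y :=
    summable_of_ne_finset_zero (s := Finset.range n) fun j hj => by rw [odd_eq_zero hj, smul_zero]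
  have mul_odd_tsum := (LinearMap.mulLeft ℝ ω).toContinuousLinearMap.map_tsum odd_summable
  simp only [LinearMap.coe_toContinuousLinearMap', LinearMap.mulLeft_apply, mul_smul_comm,
    ← ckCoeff_two_mul_add_one] at mul_odd_tsum
  let term (m : ℕ) : Octonion := (r ^ m / m.factorial) • ckCoeff ω f m y
  have term_eq_zero (m : ℕ) (hm : m ∉ Finset.range n) : term m = 0 := by
    rw [Finset.mem_range, not_lt] at hm
    simp only [term, hn m hm, smul_zero]
  have summable_term : Summable term := summable_of_ne_finset_zero term_eq_zero
  calc
    ckAt f y r ω = ∑' j, term (2 * j) + ∑' j, term (2 * j + 1) := by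
      rw [ckAt, mul_odd_tsum]
      simp only [term, ckCoeff_two_mul]
    _ = ∑' m, term m :=
      tsum_even_add_odd (summable_term.comp_injective fun i j hij => by omega)
        (summable_term.comp_injective fun i j hij => by omega)
    _ = ∑ m ∈ Finset.range n, term m := tsum_eq_sum term_eq_zero

end Coefficients

/-! ## Powers of linear forms -/

section LinearPower

variable {p : Fin 7}

/-- The power `(∑ t_l y_l) ^ n c` of a linear form, with an octonion coefficient. -/
def linearPow (t : Fin (p.val + 1) → ℝ) (n : ℕ) (c : Octonion) : (Fin (p.val + 1) → ℝ) → Octonion :=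
  fun y => (t ⬝ᵥ y) ^ n • c

-- For `n = 0` the factor `n` vanishes, so the truncated exponent `n - 1` does no harm.
theorem partialDeriv_linearPow (t : Fin (p.val + 1) → ℝ) (n : ℕ) (c : Octonion)
    (l : Fin (p.val + 1)) :
    partialDeriv l (linearPow t n c) = linearPow t (n - 1) ((n * t l) • c) := by
  funext y
  have deriv_line : HasDerivAt (fun s : ℝ => t ⬝ᵥ (y + s • Pi.single l 1)) (t l) 0 := by
    simp only [dotProduct_add, dotProduct_smul, dotProduct_single_one, smul_eq_mul]
    simpa using ((hasDerivAt_id (0 : ℝ)).mul_const (t l)).const_add (t ⬝ᵥ y)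
  have deriv_pow : HasLineDerivAt ℝ (linearPow t n c)
      (linearPow t (n - 1) ((n * t l) • c) y) y (Pi.single l 1) :=
    ((deriv_line.pow n).smul_const c).congr_deriv (by
      rw [zero_smul, add_zero, linearPow, smul_smul]
      congr 1
      ring)
  exact deriv_pow.lineDeriv

theorem negLaplacian_linearPow (t : Fin (p.val + 1) → ℝ) (n : ℕ) (c : Octonion) :
    negLaplacian (linearPow t n c) =
      linearPow t (n - 2) ((-(t ⬝ᵥ t) * n.descFactorial 2) • c) := by
  funext y
  simp only [negLaplacian, partialDeriv_linearPow, linearPow, smul_smul, ← Finset.sum_smul,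
    ← neg_smul, Nat.sub_sub, Nat.descFactorial_succ, Nat.descFactorial_zero, Nat.sub_zero,
    mul_one, Nat.cast_mul, dotProduct, ← Finset.sum_neg_distrib, Finset.sum_mul, Finset.mul_sum]
  congr 1
  exact Finset.sum_congr rfl fun l _ => by ring

theorem iterate_negLaplacian_linearPow (t : Fin (p.val + 1) → ℝ) (n : ℕ) (c : Octonion) (j : ℕ) :
    negLaplacian^[j] (linearPow t n c) =
      linearPow t (n - 2 * j) (((-(t ⬝ᵥ t)) ^ j * n.descFactorial (2 * j)) • c) := by
  induction j with
  | zero => simp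
  | succ j ih =>
    rw [Function.iterate_succ_apply', ih, negLaplacian_linearPow, smul_smul, Nat.sub_sub, mul_add,
      mul_one]
    congr 2
    simp only [Nat.descFactorial_succ, Nat.descFactorial_zero, Nat.sub_zero, Nat.sub_sub]
    push_cast
    ring

theorem cauchyRiemann_linearPow (t : Fin (p.val + 1) → ℝ) (n : ℕ) :
    cauchyRiemann (linearPow t n (e 0)) = linearPow t (n - 1) ((n : ℝ) • ofHead p t) := by
  funext y
  simp only [cauchyRiemann, partialDeriv_linearPow, linearPow, mul_smul_comm, mul_e_zero, ofHead,
    Finset.smul_sum, smul_smul]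

theorem linearPow_eq_sum (t : Fin (p.val + 1) → ℝ) (n : ℕ) :
    linearPow t n (e 0) = fun y => ∑ k ∈ Finset.piAntidiag Finset.univ n,
      (Nat.multinomial Finset.univ k * ∏ l, t l ^ k l) • monomialFun k y := by
  funext y
  rw [linearPow, dotProduct, Finset.sum_pow_eq_sum_piAntidiag, Finset.sum_smul]
  refine Finset.sum_congr rfl fun k _ => ?_
  simp only [monomialFun, smul_smul, mul_pow, Finset.prod_mul_distrib, mul_assoc]

theorem ckCoeff_linearPow {ω : Octonion} (hω : ω ∈ unitSphere p) (t y : Fin (p.val + 1) → ℝ)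
    (n m : ℕ) : ckCoeff ω (linearPow t n (e 0)) m y =
      (n.descFactorial m * (t ⬝ᵥ y) ^ (n - m)) •
        quadraticHom (mul_ofHead_mul_self hω t) (QuadraticAlgebra.omega ^ m) := by
  obtain ⟨j, rfl | rfl⟩ := Nat.even_or_odd' m
  · rw [ckCoeff_two_mul, quadraticHom_omega_pow_two_mul, iterate_negLaplacian_linearPow, linearPow,
      smul_smul, smul_smul]
    congr 1
    ring
  · have descFactorial_succ' : n.descFactorial (2 * j + 1) = n * (n - 1).descFactorial (2 * j) := by
      cases n with
      | zero => simp
      | succ n => rw [Nat.succ_descFactorial_succ, Nat.add_sub_cancel]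
    rw [ckCoeff_two_mul_add_one, quadraticHom_omega_pow_two_mul_add_one, cauchyRiemann_linearPow,
      iterate_negLaplacian_linearPow, linearPow, mul_smul_comm, mul_smul_comm, mul_smul_comm,
      smul_smul, smul_smul, smul_smul, descFactorial_succ', Nat.sub_sub, add_comm 1]
    push_cast
    congr 1
    ring

end LinearPower

/-! ## The generating identity -/

section Generating

variable {p : Fin 7}

theorem sum_smul_fueterVarAt {ω : Octonion} (hω : ω ∈ unitSphere p) (t y : Fin (p.val + 1) → ℝ)
    (r : ℝ) : ∑ l, t l • fueterVarAt p y r ω l =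
      quadraticHom (mul_ofHead_mul_self hω t) ⟨t ⬝ᵥ y, r⟩ := by
  rw [quadraticHom_mk]
  simp only [fueterVarAt, ofHead, smul_add, Finset.sum_add_distrib, dotProduct,
    Finset.mul_sum, Finset.smul_sum, Finset.sum_smul, smul_smul, smul_mul_assoc, mul_smul_comm,
    mul_comm r]

theorem sum_smul_ckCoeff_monomialFun (ω : Octonion) (t y : Fin (p.val + 1) → ℝ) (n m : ℕ) :
    ∑ k ∈ Finset.piAntidiag Finset.univ n, (∏ l, t l ^ k l) •
        ((∏ l, (k l).factorial : ℕ) : ℝ)⁻¹ • ckCoeff ω (monomialFun k) m y =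
      (n.factorial : ℝ)⁻¹ • ckCoeff ω (linearPow t n (e 0)) m y := by
  rw [linearPow_eq_sum, ckCoeff_sum_smul ω _ _ fun k => contDiff_monomialFun k, Finset.smul_sum]
  refine Finset.sum_congr rfl fun k hk => ?_
  have multinomial_spec := Nat.multinomial_spec Finset.univ k
  rw [(Finset.mem_piAntidiag.1 hk).1] at multinomial_spec
  have factorial_ne_zero : (n.factorial : ℝ) ≠ 0 := mod_cast n.factorial_ne_zero
  have prod_factorial_ne_zero : ((∏ l, (k l).factorial : ℕ) : ℝ) ≠ 0 :=
    mod_cast (Nat.prod_factorial_pos Finset.univ k).ne'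
  rw [smul_smul, smul_smul]
  congr 1
  field_simp
  rw [← multinomial_spec]
  push_cast
  ring

theorem ckCoeff_monomialFun_eq_zero {ω : Octonion} (hω : ω ∈ unitSphere p)
    {k : Fin (p.val + 1) → ℕ} {m : ℕ} (hm : degree k < m) (y : Fin (p.val + 1) → ℝ) :
    ckCoeff ω (monomialFun k) m y = 0 := by
  have prod_factorial_ne_zero : ((∏ l, (k l).factorial : ℕ) : ℝ) ≠ 0 :=
    mod_cast (Nat.prod_factorial_pos Finset.univ k).ne'
  rw [← smul_eq_zero_iff_right (inv_ne_zero prod_factorial_ne_zero)]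
  refine eq_of_sum_prod_pow_smul_eq (R := ℝ) (S := Finset.piAntidiag Finset.univ (degree k))
    (A := fun k => ((∏ l, (k l).factorial : ℕ) : ℝ)⁻¹ • ckCoeff ω (monomialFun k) m y)
    (B := fun _ => 0) (fun t => ?_) (by simp)
  rw [sum_smul_ckCoeff_monomialFun, ckCoeff_linearPow hω, Nat.descFactorial_of_lt hm]
  simp only [Nat.cast_zero, zero_mul, zero_smul, smul_zero, Finset.sum_const_zero]

theorem sum_smul_ckAt_monomialFun {ω : Octonion} (hω : ω ∈ unitSphere p)
    (t y : Fin (p.val + 1) → ℝ) (r : ℝ) (n : ℕ) :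
    ∑ k ∈ Finset.piAntidiag Finset.univ n, (∏ l, t l ^ k l) •
        ((∏ l, (k l).factorial : ℕ) : ℝ)⁻¹ • ckAt (monomialFun k) y r ω =
      (n.factorial : ℝ)⁻¹ • quadraticHom (mul_ofHead_mul_self hω t) (⟨t ⬝ᵥ y, r⟩ ^ n) := by
  have ω_ne_zero : ω ≠ 0 := norm_ne_zero_iff.1 (by simp [unitSphere_norm hω])
  calc
    _ = ∑ k ∈ Finset.piAntidiag Finset.univ n, ∑ m ∈ Finset.range (n + 1),
          (r ^ m / m.factorial) • (∏ l, t l ^ k l) •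
            ((∏ l, (k l).factorial : ℕ) : ℝ)⁻¹ • ckCoeff ω (monomialFun k) m y := by
      refine Finset.sum_congr rfl fun k hk => ?_
      have degree_eq : degree k = n := (Finset.mem_piAntidiag.1 hk).1
      rw [ckAt_eq_sum_range ω_ne_zero fun m hm =>
        ckCoeff_monomialFun_eq_zero hω (degree_eq.trans_lt hm) y]
      simp only [Finset.smul_sum, smul_comm (r ^ _ / _)]
    _ = ∑ m ∈ Finset.range (n + 1), (r ^ m / m.factorial) • (n.factorial : ℝ)⁻¹ •
          (n.descFactorial m * (t ⬝ᵥ y) ^ (n - m)) •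
            quadraticHom (mul_ofHead_mul_self hω t) (QuadraticAlgebra.omega ^ m) := by
      rw [Finset.sum_comm]
      simp only [← Finset.smul_sum, sum_smul_ckCoeff_monomialFun, ckCoeff_linearPow hω]
    _ = _ := by
      rw [quadraticHom_mk_pow, Finset.smul_sum]
      refine Finset.sum_congr rfl fun m _ => ?_
      have factorial_ne_zero : (m.factorial : ℝ) ≠ 0 := mod_cast m.factorial_ne_zero
      rw [smul_comm, smul_smul (r ^ m / _), Nat.descFactorial_eq_factorial_mul_choose]
      push_cast
      congr 2
      field_simp

theorem inv_factorial_smul_ckAt_monomialFun {ω : Octonion} (hω : ω ∈ unitSphere p)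
    (y : Fin (p.val + 1) → ℝ) (r : ℝ) {n : ℕ}
    {F : MultilinearMap ℝ (fun _ : Fin n => Octonion) Octonion} (hF : ComputesPowers F)
    {k : Fin (p.val + 1) → ℕ} (hk : degree k = n) :
    ((∏ l, (k l).factorial : ℕ) : ℝ)⁻¹ • ckAt (monomialFun k) y r ω = (n.factorial : ℝ)⁻¹ •
      ∑ s ∈ arrangements n k, F fun m => fueterVarAt p y r ω (s m) := by
  refine eq_of_sum_prod_pow_smul_eq (R := ℝ) (S := Finset.piAntidiag Finset.univ n)
    (A := fun k => ((∏ l, (k l).factorial : ℕ) : ℝ)⁻¹ • ckAt (monomialFun k) y r ω)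
    (B := fun k => (n.factorial : ℝ)⁻¹ •
      ∑ s ∈ arrangements n k, F fun m => fueterVarAt p y r ω (s m))
    (fun t => ?_) (by simp [hk])
  simp only [smul_comm _ (n.factorial : ℝ)⁻¹]
  rw [← Finset.smul_sum, ← multilinearMap_sum_smul_eq_sum_piAntidiag, sum_smul_fueterVarAt hω,
    hF, ← sum_smul_ckAt_monomialFun hω]

theorem ckMonomial_eq_of_computesPowers (k : Fin (p.val + 1) → ℕ) (x : Octonion)
    {F : MultilinearMap ℝ (fun _ : Fin (degree k) => Octonion) Octonion} (hF : ComputesPowers F) :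
    ckMonomial k x = ((degree k).factorial : ℝ)⁻¹ •
      ∑ s ∈ alignments k, F fun m => fueterVar p (s m) x := by
  have alignments_eq : alignments k = arrangements (degree k) k := by
    ext s
    simp [alignments, mem_arrangements]
  rw [alignments_eq]
  exact inv_factorial_smul_ckAt_monomialFun (eq_head_add p x).2.2 _ _ hF rfl

theorem ckMonomial_eq_fueterPoly (k : Fin (p.val + 1) → ℕ) (x : Octonion) :
    ckMonomial k x = fueterPoly k x := by
  rw [ckMonomial_eq_of_computesPowers k x (computesPowers_leftProdMultilinear _), fueterPoly]
  simp only [leftProdMultilinear_apply]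

theorem ckMonomial_eq_fueterPolyWith (k : Fin (p.val + 1) → ℕ) (B : Bracketing (degree k))
    (x : Octonion) : ckMonomial k x = fueterPolyWith k B x := by
  rw [ckMonomial_eq_of_computesPowers k x B.computesPowers, fueterPolyWith]
  simp only [Bracketing.prodMultilinear_apply]

end Generating

end

end OctonionFueter

theorem mainTheorem10 (p : Fin 7) (k : Fin (p.val + 1) → ℕ) (x : OctonionFueter.Octonion) :
    OctonionFueter.ckMonomial k x = OctonionFueter.fueterPoly k x ∧
      ∀ B : OctonionFueter.Bracketing (OctonionFueter.degree k),
        OctonionFueter.fueterPolyWith k B x = OctonionFueter.fueterPoly k x :=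
  ⟨OctonionFueter.ckMonomial_eq_fueterPoly k x, fun B =>
    (OctonionFueter.ckMonomial_eq_fueterPolyWith k B x).symm.trans
      (OctonionFueter.ckMonomial_eq_fueterPoly k x)⟩
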